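/- Let $R_n$ be the rook monoid, i.e. the set of injective partial functions from $\{1,\dots,n\}$ to itself, with $s\le t$ iff $t$ extends $s$, and let $\mathrm{rk}(s)=|\mathrm{dom}(s)|$. For $s\in R_n$ let $d_1(s)<d_2(s)<\cdots$ be the elements of $\{1,\dots,n\}\setminus\mathrm{dom}(s)$ and $r_1(s)<r_2(s)<\cdots$ those of $\{1,\dots,n\}\setminus\mathrm{ran}(s)$. For $f:R_n\to\mathbb C$ and $0\le m\le n-\mathrm{rk}(s)$, put $$\zeta_f^{(m)}(s)=\sum_{\substack{t\ge s:\ d_1(s),\dots,d_m(s)\notin\mathrm{dom}(t)\\ r_1(s),\dots,r_m(s)\notin\mathrm{ran}(t)}} f(t),\qquad \zeta_f(s)=\zeta_f^{(0)}(s)=\sum_{t\ge s}f(t),\qquad \zeta_f^{(n-\mathrm{rk}(s))}(s)=f(s).$$ For $a\notin\mathrm{dom}(s)$, $b\notin\mathrm{ran}(s)$, let $s*(a\to b)$ be the extension of $s$ that sends $a$ to $b$. The fast zeta transform for $R_n$ is the following algorithm. Throughout, one memory cell is reserved for each input $f(s)$ and one for each output $\zeta_f(s)$; the other values $\zeta_f^{(m)}(s)$,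 $0<m<n-\mathrm{rk}(s)$, are kept in work cells. For $k=n,n-1,\dots,0$, step $n-k$ first discards the work cells of the elements of rank $k+3$ (those of higher rank have been discarded before), then allocates the $n-k-1$ work cells (none if $k=n$) of each element of rank $k$, and then, for each $s$ of rank $k$ and for $m=n-k-1,\dots,0$ in this order, computes $\zeta_f^{(m)}(s)$ by accumulating, one addition or subtraction at a time, the terms of $$\begin{aligned}\zeta_f^{(m)}(s)={}&\zeta_f^{(m+1)}(s)+\sum_{i=m+1}^{n-k}\zeta_f^{(m)}\bigl(s*(d_i(s)\to r_{m+1}(s))\bigr)+\sum_{j=m+2}^{n-k}\zeta_f^{(m)}\bigl(s*(d_{m+1}(s)\to r_j(s))\bigr)\\&-\sum_{i,j=m+2}^{n-k}\zeta_f^{(m)}\bigl(s*(d_i(s)\to r_{m+1}(s))*(d_{m+1}(s)\to r_j(s))\bigr)\end{aligned}$$ (for $k=n$ it just copies $f(s)$ to the output $\zeta_f(s)$). **Theorem.** There is a constant $C$ such that for every $n\ge1$ and every $f:R_n\to\mathbb C$: 1. the execution of the algorithm never accesses a cell that is not allocated, and at every point of it at most $C\,n^{1/4}|R_n|$ complex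 numbers are stored (inputs and outputs included); 2. for every $k\le n$, after step $n-k$ all the values $\zeta_f^{(m)}(s)$ with $\mathrm{rk}(s)=k$, $0\le m\le n-k$, are correctly in memory, and at the end all outputs $\zeta_f(s)$, $s\in R_n$, are correctly in memory. Moreover $$\max_{k\in\{0,1,\dots,n-1\}}(n-k-1)\binom nk^2k!=O\bigl(n^{1/4}|R_n|\bigr)\qquad(n\ge 1).$$ -/

import Mathlib

open scoped Nat

namespace RookZeta

/-- The rook monoid (symmetric inverse semigroup): all injective partial functions from an
`n`-element set to itself. Mathlib's order on it is `s ≤ t ↔ t extends s`; see `le_iff_natural`. -/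
abbrev Rook (n : ℕ) : Type := Fin n ≃. Fin n

noncomputable instance instFintypeRook (n : ℕ) : Fintype (Rook n) :=
  Fintype.ofInjective (fun s : Rook n => (s : Fin n → Option (Fin n))) DFunLike.coe_injective

/-- `s ≤ t` is the natural partial order of the inverse semigroup: `s = t ∘ e` for an
idempotent `e`. -/
theorem le_iff_natural {n : ℕ} (s t : Rook n) :
    s ≤ t ↔ ∃ e : Rook n, e.trans e = e ∧ s = e.trans t := by
  classical
  constructor
  · intro h
    have hE : ∀ x y, y ∈ PEquiv.ofSet {x | s x ≠ none} x ↔ y = x ∧ s y ≠ none :=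
      fun x y => PEquiv.mem_ofSet_iff.trans
        ⟨fun hxy => ⟨hxy.1, hxy.1 ▸ hxy.2⟩, fun hxy => ⟨hxy.1, hxy.1 ▸ hxy.2⟩⟩
    refine ⟨PEquiv.ofSet {x | s x ≠ none}, ?_, ?_⟩
    · refine PEquiv.ext fun x => Option.ext fun y => ?_
      change y ∈ ((PEquiv.ofSet {x | s x ≠ none}).trans (PEquiv.ofSet {x | s x ≠ none})) x ↔
        y ∈ (PEquiv.ofSet {x | s x ≠ none}) x
      rw [PEquiv.mem_trans]
      constructor
      · rintro ⟨b, hb, hy⟩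
        rwa [((hE x b).1 hb).1] at hy
      · intro hy
        refine ⟨x, (hE x x).2 ⟨rfl, ?_⟩, hy⟩
        rw [← ((hE x y).1 hy).1]
        exact ((hE x y).1 hy).2
    · refine PEquiv.ext fun x => Option.ext fun y => ?_
      change y ∈ s x ↔ y ∈ ((PEquiv.ofSet {x | s x ≠ none}).trans t) x
      rw [PEquiv.mem_trans]
      constructor
      · intro hy
        refine ⟨x, (hE x x).2 ⟨rfl, fun h0 => ?_⟩, h x y hy⟩
        rw [h0] at hy
        exact Option.not_mem_none y hy
      · rintro ⟨b, hb, hy⟩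
        obtain ⟨rfl, hb'⟩ := (hE x b).1 hb
        obtain ⟨z, hz⟩ := Option.ne_none_iff_exists'.1 hb'
        have hz' : z ∈ s b := hz
        rwa [Option.mem_unique hy (h b z hz')]
  · rintro ⟨e, he, rfl⟩ x y hy
    obtain ⟨b, hb, hy⟩ := (PEquiv.mem_trans _ _ _ _).1 hy
    have h1 : b ∈ e.trans e x := by rw [he]; exact hb
    obtain ⟨c, hc, hcb⟩ := (PEquiv.mem_trans _ _ _ _).1 h1
    obtain rfl : c = b := Option.mem_unique hc hb
    have hx : x = c := PEquiv.inj e hb hcb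
    rwa [hx]

/-- The domain of a partial injection. -/
def dom {n : ℕ} (s : Rook n) : Finset (Fin n) := Finset.univ.filter fun x => s x ≠ none

/-- The range of a partial injection. -/
def ran {n : ℕ} (s : Rook n) : Finset (Fin n) := Finset.univ.filter fun y => s.symm y ≠ none

/-- The rank of a partial injection. -/
def rk {n : ℕ} (s : Rook n) : ℕ := (dom s).card

/-- The points `d₁(s) < d₂(s) < ⋯` outside the domain of `s`, in increasing order. -/
def freeDom {n : ℕ} (s : Rook n) : List (Fin n) := (dom s)ᶜ.sort (· ≤ ·)

/-- The points `r₁(s) < r₂(s) < ⋯` outside the range of `s`, in increasing order. -/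
def freeRan {n : ℕ} (s : Rook n) : List (Fin n) := (ran s)ᶜ.sort (· ≤ ·)

/-- `s * (a → b)`: add `a` to the domain of `s` and send it to `b`. It is used only for
`a ∉ dom s`, `b ∉ ran s`; in the other cases the pairs of `s` in conflict with `a ↦ b` are dropped. -/
def extend {n : ℕ} (s : Rook n) (a b : Fin n) : Rook n where
  toFun x := if x = a then some b else if s x = some b then none else s x
  invFun y := if y = b then some a else if s.symm y = some a then none else s.symm y
  inv x y := by
    have h : s.symm y = some x ↔ s x = some y := PEquiv.eq_some_iff s
    change (if y = b then some a else if s.symm y = some a then none else s.symm y) = some x ↔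
      (if x = a then some b else if s x = some b then none else s x) = some y
    by_cases hx : x = a <;> by_cases hy : y = b
    · rw [if_pos hx, if_pos hy, hx, hy]
      exact ⟨fun _ => rfl, fun _ => rfl⟩
    · rw [if_pos hx, if_neg hy]
      refine ⟨fun h0 => ?_, fun h0 => absurd (Option.some.inj h0).symm hy⟩
      rw [hx] at h0
      split_ifs at h0 with h1
      exact absurd h0 h1
    · rw [if_neg hx, if_pos hy]
      refine ⟨fun h0 => absurd (Option.some.inj h0).symm hx, fun h0 => ?_⟩
      rw [hy] at h0
      split_ifs at h0 with h1
      exact absurd h0 h1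
    · rw [if_neg hx, if_neg hy]
      constructor
      · intro h0
        split_ifs at h0 with h1
        rw [if_neg (fun h2 => hy (Option.some.inj ((h.1 h0).symm.trans h2)))]
        exact h.1 h0
      · intro h0
        split_ifs at h0 with h1
        rw [if_neg (fun h2 => hx (Option.some.inj ((h.2 h0).symm.trans h2)))]
        exact h.2 h0

open Classical in
/-- The zeta transform `ζ_f(s) = ∑_{t ≥ s} f(t)`. -/
noncomputable def zeta {n : ℕ} (f : Rook n → ℂ) (s : Rook n) : ℂ :=
  ∑ t with s ≤ t, f t

open Classical in
/-- The partial zeta transform `ζ_f(s, {d₁(s),…,dₘ(s)}, {r₁(s),…,rₘ(s)})`: the sum of `f t` over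
all `t ≥ s` with `d₁(s),…,dₘ(s) ∉ dom t` and `r₁(s),…,rₘ(s) ∉ ran t`. -/
noncomputable def partialZeta {n : ℕ} (f : Rook n → ℂ) (s : Rook n) (m : ℕ) : ℂ :=
  ∑ t with s ≤ t ∧ (∀ x ∈ (freeDom s).take m, x ∉ dom t) ∧ (∀ y ∈ (freeRan s).take m, y ∉ ran t),
    f t

/-! ### The machine: a memory whose cells each store one complex number -/

/-- Names of memory cells: the input `f(s)`, the output `ζ_f(s)`, and a work cell for the `m`-th
partial zeta transform at `s`. -/
inductive Cell (n : ℕ) : Type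
  | input (s : Rook n)
  | output (s : Rook n)
  | work (s : Rook n) (m : ℕ)

noncomputable instance instDecidableEqCell (n : ℕ) : DecidableEq (Cell n) := Classical.decEq _

/-- A memory state: the finite set of cells currently held, and their contents (the contents of a
cell that is not held are inaccessible, see `Instr.exec`). -/
structure Memory (n : ℕ) : Type where
  cells : Finset (Cell n)
  val : Cell n → ℂ

/-- The instructions. `add dst src` replaces the content of `dst` by its sum with that of `src`, and
similarly `sub`, so no hidden temporary storage is used. -/
inductive Instr (n : ℕ) : Type
  | alloc (c : Cell n)
  | free (c : Cell n)
  | copy (dst src : Cell n)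
  | add (dst src : Cell n)
  | sub (dst src : Cell n)

/-- Execution of one instruction; it fails (`none`) if it accesses or frees a cell that is not held
or allocates one that is. A freshly allocated cell holds `0`. -/
noncomputable def Instr.exec {n : ℕ} (M : Memory n) : Instr n → Option (Memory n)
  | .alloc c =>
      if c ∈ M.cells then none else some ⟨insert c M.cells, Function.update M.val c 0⟩
  | .free c =>
      if c ∈ M.cells then some ⟨M.cells.erase c, M.val⟩ else none
  | .copy dst src =>
      if dst ∈ M.cells ∧ src ∈ M.cells then
        some ⟨M.cells, Function.update M.val dst (M.val src)⟩ else none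
  | .add dst src =>
      if dst ∈ M.cells ∧ src ∈ M.cells then
        some ⟨M.cells, Function.update M.val dst (M.val dst + M.val src)⟩ else none
  | .sub dst src =>
      if dst ∈ M.cells ∧ src ∈ M.cells then
        some ⟨M.cells, Function.update M.val dst (M.val dst - M.val src)⟩ else none

/-- Execution of a straight-line program. -/
noncomputable def run {n : ℕ} (p : List (Instr n)) (M : Memory n) : Option (Memory n) :=
  p.foldlM Instr.exec M

/-- The initial memory: a cell for every input `f(s)` and a cell, still `0`, for every output. -/
noncomputable def initialMemory {n : ℕ} (f : Rook n → ℂ) : Memory n where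
  cells := Finset.univ.image Cell.input ∪ Finset.univ.image Cell.output
  val
    | .input s => f s
    | _ => 0

/-! ### The fast zeta transform -/

/-- The elements of rank `k`, listed in some order. -/
noncomputable def elemsOfRank (n k : ℕ) : List (Rook n) :=
  (Finset.univ.filter fun s : Rook n => rk s = k).toList

/-- Where the `m`-th partial zeta transform at `s` is stored, for `0 ≤ m ≤ n - rk s`. For
`m = n - rk s` it is `f(s)` and for `m = 0` it is `ζ_f(s)`, so work cells are
needed only for `0 < m < n - rk s`. -/
def loc {n : ℕ} (s : Rook n) (m : ℕ) : Cell n :=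
  if m = n - rk s then .input s else if m = 0 then .output s else .work s m

/-- The work cells of the elements of rank `k`: `n - k - 1` for each of them. -/
noncomputable def workCells (n k : ℕ) : List (Cell n) :=
  (elemsOfRank n k).flatMap fun s => (List.range' 1 (n - k - 1)).map fun m => .work s m

/-- Computation of the `m`-th partial zeta transform at `s`, for `m < n - rk s`, by
`ζ_f(s,D,R) = ζ_f(s, D ∪ {d_{m+1}}, R ∪ {r_{m+1}})
  + ∑_{i ≥ m+1} ζ_f(s*(d_i → r_{m+1}), D, R) + ∑_{j ≥ m+2} ζ_f(s*(d_{m+1} → r_j), D, R)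
  - ∑_{i,j ≥ m+2} ζ_f(s*(d_i → r_{m+1})*(d_{m+1} → r_j), D, R)`
with `D = {d₁,…,dₘ}`, `R = {r₁,…,rₘ}`, `dᵢ = dᵢ(s)`, `rᵢ = rᵢ(s)`. -/
def computePartial {n : ℕ} (s : Rook n) (m : ℕ) : List (Instr n) :=
  match (freeDom s).drop m, (freeRan s).drop m with
  | d :: ds, r :: rs =>
      [.copy (loc s m) (loc s (m + 1))]
        ++ (d :: ds).map (fun d' => .add (loc s m) (loc (extend s d' r) m))
        ++ rs.map (fun r' => .add (loc s m) (loc (extend s d r') m))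
        ++ ds.flatMap fun d' => rs.map fun r' =>
            .sub (loc s m) (loc (extend (extend s d' r) d r') m)
  | _, _ => []

/-- Computation of all partial zeta transforms at an element `s`, for `m` from `n - rk s` down to
`0`. Nothing has to be done for `m = n - rk s`, except that for `rk s = n` the
value `f(s)` is the output `ζ_f(s)`. -/
def computeAll {n : ℕ} (s : Rook n) : List (Instr n) :=
  if rk s = n then [.copy (.output s) (.input s)]
  else (List.range (n - rk s)).reverse.flatMap (computePartial s)

/-- Step `n - k` of the algorithm: discard the work cells of the elements of rank `k + 3` (those of
higher rank have been discarded before), allocate the work cells of the elements of rank `k`, and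
compute all partial zeta transforms at the elements of rank `k`. -/
noncomputable def step (n k : ℕ) : List (Instr n) :=
  (workCells n (k + 3)).map .free ++ (workCells n k).map .alloc
    ++ (elemsOfRank n k).flatMap computeAll

/-- Steps `0, 1, …, j - 1` of the algorithm, i.e. ranks `n, n - 1, …, n - j + 1`. -/
noncomputable def steps (n j : ℕ) : List (Instr n) :=
  (List.range j).flatMap fun i => step n (n - i)

/-- The fast zeta transform: steps `0, 1, …, n`. -/
noncomputable def fastZeta (n : ℕ) : List (Instr n) := steps n (n + 1)

end RookZeta

namespace RookZeta

/-! The recurrence is inclusion–exclusion. Let d, r be the (m+1)-st free points of s. Extending s by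
a pair a → b of free points beyond the m-th leaves the first m free points alone, so the m-th
partial transform at s*(a → b) collects exactly those terms t of the one at s with t a = b
(`admissible_extend`). A term avoiding both d and r belongs to index m + 1. Otherwise r ∈ ran t or d
∈ dom t: the single sums count these cases, with d → r only in the first, and the double sum removes
what was counted twice (`partialZeta_recurrence`).

At rank k only ranks k, k + 1, k + 2 are read, so three layers of work cells suffice and at most
2|R_n| + 3 `maxWork n` cells are ever held. `Exec` carries this bound along with the contents, and
`exec_step` propagates `StepInvariant` from rank k + 1 to rank k.

For `maxWork_le`, let N_j be the number of elements of corank j. Since N_{j+1}/N_j = (n-j)/(j+1)²,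
the product (j-1)N_j does not increase once j² ≥ n, so it suffices to bound it at some i with i - 1
≤ √n. Put x = n^{1/4}. If x ≥ 4, then N_J ≤ e^{4/x} N_{J+1} for J ≤ x² + x, so each of the ⌊x⌋ + 1
coranks from i on has at least e^{-4} N_i elements. Hence x N_i ≤ e⁴|R_n|, and (i-1)N_i ≤ x² N_i ≤
e⁴ x |R_n|. For x < 4 the bound N_i ≤ |R_n| is enough. -/

variable {n : ℕ}

/-! ### Domain, range and free points of one-pair extensions -/

theorem mem_dom {s : Rook n} {x : Fin n} : x ∈ dom s ↔ ∃ y, s x = some y := by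
  simp [dom, Option.ne_none_iff_exists']

theorem mem_ran {s : Rook n} {y : Fin n} : y ∈ ran s ↔ ∃ x, s x = some y := by
  simp [ran, Option.ne_none_iff_exists', PEquiv.eq_some_iff]

theorem apply_inj {s : Rook n} {x x' y : Fin n} (h : s x = some y) (h' : s x' = some y) :
    x = x' :=
  PEquiv.inj s h h'

theorem le_iff_apply {s t : Rook n} : s ≤ t ↔ ∀ x y, s x = some y → t x = some y :=
  Iff.rfl

theorem extend_apply {s : Rook n} {a b : Fin n} (hb : b ∉ ran s) (x : Fin n) :
    extend s a b x = if x = a then some b else s x := by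
  change (if x = a then some b else if s x = some b then none else s x) = _
  rw [if_neg fun h => hb (mem_ran.2 ⟨x, h⟩)]

theorem extend_le {s t : Rook n} {a b : Fin n} (ha : a ∉ dom s) (hb : b ∉ ran s) :
    extend s a b ≤ t ↔ s ≤ t ∧ t a = some b := by
  simp only [le_iff_apply, extend_apply hb]
  constructor
  · refine fun h => ⟨fun x y hxy => h x y ?_, h a b (if_pos rfl)⟩
    rw [if_neg, hxy]
    rintro rfl
    exact ha (mem_dom.2 ⟨y, hxy⟩)
  · rintro ⟨h, hab⟩ x y hxy
    split_ifs at hxy with hx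
    · rw [hx, hab, hxy]
    · exact h x y hxy

theorem dom_extend {s : Rook n} {a b : Fin n} (hb : b ∉ ran s) :
    dom (extend s a b) = insert a (dom s) := by
  ext x
  rw [Finset.mem_insert, mem_dom, mem_dom]
  simp only [extend_apply hb]
  by_cases hx : x = a <;> simp [hx]

theorem ran_extend {s : Rook n} {a b : Fin n} (ha : a ∉ dom s) (hb : b ∉ ran s) :
    ran (extend s a b) = insert b (ran s) := by
  ext y
  rw [Finset.mem_insert, mem_ran, mem_ran]
  simp only [extend_apply hb]
  constructor
  · rintro ⟨x, hx⟩
    split_ifs at hx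
    · exact Or.inl (Option.some.inj hx).symm
    · exact Or.inr ⟨x, hx⟩
  · rintro (rfl | ⟨x, hx⟩)
    · exact ⟨a, if_pos rfl⟩
    · refine ⟨x, ?_⟩
      rw [if_neg, hx]
      rintro rfl
      exact ha (mem_dom.2 ⟨y, hx⟩)

theorem rk_extend {s : Rook n} {a b : Fin n} (ha : a ∉ dom s) (hb : b ∉ ran s) :
    rk (extend s a b) = rk s + 1 := by
  rw [rk, dom_extend hb, Finset.card_insert_of_notMem ha, rk]

theorem rk_le (s : Rook n) : rk s ≤ n :=
  (Finset.card_le_univ (dom s)).trans (Fintype.card_fin n).le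

/-- Makes `freeDom s` and `freeRan s` equally long, so that the default branch of `computePartial`
never occurs for `m < n - rk s`. -/
theorem card_ran (s : Rook n) : (ran s).card = rk s := by
  symm
  refine Finset.card_bij (fun x hx => (mem_dom.1 hx).choose) ?_ ?_ ?_
  · exact fun x hx => mem_ran.2 ⟨x, (mem_dom.1 hx).choose_spec⟩
  · intro x hx x' hx' h
    have h' := (mem_dom.1 hx').choose_spec
    rw [← h] at h'
    exact apply_inj (mem_dom.1 hx).choose_spec h'
  · intro y hy
    obtain ⟨x, hx⟩ := mem_ran.1 hy
    refine ⟨x, mem_dom.2 ⟨y, hx⟩, ?_⟩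
    exact Option.some.inj (((mem_dom.1 (mem_dom.2 ⟨y, hx⟩)).choose_spec).symm.trans hx)

theorem mem_freeDom {s : Rook n} {x : Fin n} : x ∈ freeDom s ↔ x ∉ dom s := by
  simp [freeDom]

theorem mem_freeRan {s : Rook n} {y : Fin n} : y ∈ freeRan s ↔ y ∉ ran s := by
  simp [freeRan]

theorem nodup_freeDom (s : Rook n) : (freeDom s).Nodup := Finset.sort_nodup _ _

theorem nodup_freeRan (s : Rook n) : (freeRan s).Nodup := Finset.sort_nodup _ _

theorem length_freeDom (s : Rook n) : (freeDom s).length = n - rk s := by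
  simp [freeDom, Finset.card_compl, rk]

theorem length_freeRan (s : Rook n) : (freeRan s).length = n - rk s := by
  simp [freeRan, Finset.card_compl, card_ran]

theorem sort_compl_insert {A : Finset (Fin n)} (a : Fin n) :
    (insert a A)ᶜ.sort (· ≤ ·) = (Aᶜ.sort (· ≤ ·)).erase a := by
  refine List.Perm.eq_of_pairwise (le := (· ≤ ·)) (fun _ _ _ _ => le_antisymm)
    (Finset.pairwise_sort _ _) ((Finset.pairwise_sort _ _).sublist List.erase_sublist) ?_
  rw [List.perm_ext_iff_of_nodup (Finset.sort_nodup _ _) ((Finset.sort_nodup _ _).erase _)]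
  intro x
  rw [(Finset.sort_nodup _ _).mem_erase_iff]
  simp [Finset.mem_compl]

theorem freeDom_extend {s : Rook n} {a b : Fin n} (hb : b ∉ ran s) :
    freeDom (extend s a b) = (freeDom s).erase a := by
  rw [freeDom, dom_extend hb, sort_compl_insert, freeDom]

theorem freeRan_extend {s : Rook n} {a b : Fin n} (ha : a ∉ dom s) (hb : b ∉ ran s) :
    freeRan (extend s a b) = (freeRan s).erase b := by
  rw [freeRan, ran_extend ha hb, sort_compl_insert, freeRan]

/-- This is why s and its extension by a pair beyond position m have the same m forbidden points on
either side. -/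
theorem take_erase_of_mem_drop {α : Type*} [DecidableEq α] {l : List α} (hl : l.Nodup) {m : ℕ}
    {a : α} (ha : a ∈ l.drop m) : (l.erase a).take m = l.take m := by
  have hm : m ≤ l.length := by
    by_contra h
    rw [List.drop_eq_nil_of_le (by omega)] at ha
    exact List.not_mem_nil ha
  have hnot : a ∉ l.take m := fun h => by
    rw [← List.take_append_drop m l] at hl
    exact List.disjoint_of_nodup_append hl h ha
  conv_lhs => rw [← List.take_append_drop m l, List.erase_append_right _ hnot]
  rw [List.take_append_of_le_length (by simp [hm]), List.take_take, min_self]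

theorem mem_drop_erase {α : Type*} [DecidableEq α] {l : List α} {m : ℕ}
    {a b : α} (hl : l.Nodup) (ha : a ∈ l.drop m) (hb : b ∈ l.drop m) (hab : a ≠ b) :
    a ∈ (l.erase b).drop m := by
  have h : a ∈ (l.erase b).take m ++ (l.erase b).drop m := by
    rw [List.take_append_drop]
    exact (List.mem_erase_of_ne hab).2 (List.mem_of_mem_drop ha)
  rw [take_erase_of_mem_drop hl hb] at h
  refine (List.mem_append.1 h).resolve_left fun h' => ?_
  rw [← List.take_append_drop m l] at hl
  exact List.disjoint_of_nodup_append hl h' ha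

/-! ### The recurrence for the partial zeta transforms -/

/-- The index set of the sum defining the `m`-th partial zeta transform at `s`. -/
def Admissible (s : Rook n) (m : ℕ) (t : Rook n) : Prop :=
  s ≤ t ∧ (∀ x ∈ (freeDom s).take m, x ∉ dom t) ∧ ∀ y ∈ (freeRan s).take m, y ∉ ran t

open Classical in
-- With every transform a sum over all t, the recurrence can be checked one coefficient at a time.
theorem partialZeta_eq_sum_ite (f : Rook n → ℂ) (s : Rook n) (m : ℕ) :
    partialZeta f s m = ∑ t, if Admissible s m t then f t else 0 := by
  rw [partialZeta, Finset.sum_filter]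
  exact Finset.sum_congr rfl fun t _ => if_congr Iff.rfl rfl rfl

theorem partialZeta_zero (f : Rook n → ℂ) (s : Rook n) : partialZeta f s 0 = zeta f s :=
  Finset.sum_congr (by ext; simp only [Finset.mem_filter]; simp) fun _ _ => rfl

theorem admissible_corank {s t : Rook n} : Admissible s (n - rk s) t ↔ t = s := by
  constructor
  · rintro ⟨h, hd, -⟩
    rw [List.take_of_length_le (length_freeDom s).le] at hd
    refine le_antisymm (le_iff_apply.2 fun x y hxy => ?_) h
    have hx : x ∈ dom s := by
      by_contra hx
      exact hd x (mem_freeDom.2 hx) (mem_dom.2 ⟨y, hxy⟩)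
    obtain ⟨z, hz⟩ := mem_dom.1 hx
    rw [hz, ← hxy, h x z hz]
  · rintro rfl
    exact ⟨le_rfl, fun x hx => mem_freeDom.1 (List.mem_of_mem_take hx),
      fun x hx => mem_freeRan.1 (List.mem_of_mem_take hx)⟩

theorem partialZeta_corank (f : Rook n → ℂ) (s : Rook n) : partialZeta f s (n - rk s) = f s := by
  classical
  rw [partialZeta_eq_sum_ite]
  simp [admissible_corank]

theorem admissible_extend {s t : Rook n} {m : ℕ} {a b : Fin n} (ha : a ∈ (freeDom s).drop m)
    (hb : b ∈ (freeRan s).drop m) :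
    Admissible (extend s a b) m t ↔ Admissible s m t ∧ t a = some b := by
  have ha' := mem_freeDom.1 (List.mem_of_mem_drop ha)
  have hb' := mem_freeRan.1 (List.mem_of_mem_drop hb)
  rw [Admissible, Admissible, extend_le ha' hb', freeDom_extend hb', freeRan_extend ha' hb',
    take_erase_of_mem_drop (nodup_freeDom s) ha, take_erase_of_mem_drop (nodup_freeRan s) hb]
  tauto

theorem mem_drop_freeDom_extend {s : Rook n} {m : ℕ} {a b a' : Fin n}
    (ha : a ∈ (freeDom s).drop m) (hb : b ∈ (freeRan s).drop m) (ha' : a' ∈ (freeDom s).drop m)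
    (hne : a' ≠ a) : a' ∈ (freeDom (extend s a b)).drop m := by
  rw [freeDom_extend (mem_freeRan.1 (List.mem_of_mem_drop hb))]
  exact mem_drop_erase (nodup_freeDom s) ha' ha hne

theorem mem_drop_freeRan_extend {s : Rook n} {m : ℕ} {a b b' : Fin n}
    (ha : a ∈ (freeDom s).drop m) (hb : b ∈ (freeRan s).drop m) (hb' : b' ∈ (freeRan s).drop m)
    (hne : b' ≠ b) : b' ∈ (freeRan (extend s a b)).drop m := by
  rw [freeRan_extend (mem_freeDom.1 (List.mem_of_mem_drop ha))
    (mem_freeRan.1 (List.mem_of_mem_drop hb))]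
  exact mem_drop_erase (nodup_freeRan s) hb' hb hne

theorem sum_map_sum_comm {α β : Type*} (l : List α) (S : Finset β) (g : α → β → ℂ) :
    (l.map fun a => ∑ t ∈ S, g a t).sum = ∑ t ∈ S, (l.map fun a => g a t).sum := by
  induction l with
  | nil => simp
  | cons a l ih => simp [ih, Finset.sum_add_distrib]

open Classical in
-- Since t is an injective partial function, each sum in the recurrence has at most one nonzero term
-- for given t, so it becomes the indicator of an existence statement.
theorem sum_map_ite_of_unique {α : Type*} {l : List α} (hl : l.Nodup) {p : α → Prop}
    [DecidablePred p]
    (hp : ∀ a ∈ l, ∀ b ∈ l, p a → p b → a = b) (c : ℂ) :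
    (l.map fun a => if p a then c else 0).sum = if ∃ a ∈ l, p a then c else 0 := by
  induction l with
  | nil => simp
  | cons a l ih =>
    rw [List.nodup_cons] at hl
    rw [List.map_cons, List.sum_cons, ih hl.2 fun a ha b hb =>
      hp a (List.mem_cons_of_mem _ ha) b (List.mem_cons_of_mem _ hb)]
    by_cases ha : p a
    · have : ¬ ∃ b ∈ l, p b := by
        rintro ⟨b, hb, hpb⟩
        have := hp a List.mem_cons_self b (List.mem_cons_of_mem _ hb) ha hpb
        exact hl.1 (this ▸ hb)
      simp [ha, this]
    · simp [ha]

theorem partialZeta_recurrence (f : Rook n → ℂ) {s : Rook n} {m : ℕ} {d r : Fin n}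
    {ds rs : List (Fin n)} (hd : (freeDom s).drop m = d :: ds)
    (hr : (freeRan s).drop m = r :: rs) :
    partialZeta f s m = partialZeta f s (m + 1)
      + ((d :: ds).map fun d' => partialZeta f (extend s d' r) m).sum
      + (rs.map fun r' => partialZeta f (extend s d r') m).sum
      - (ds.map fun d' => (rs.map fun r' =>
          partialZeta f (extend (extend s d' r) d r') m).sum).sum := by
  classical
  have hnd : (d :: ds).Nodup := hd ▸ (nodup_freeDom s).drop
  have hnr : (r :: rs).Nodup := hr ▸ (nodup_freeRan s).drop
  have hmd : ∀ {x}, x ∈ d :: ds → x ∈ (freeDom s).drop m := fun h => hd ▸ h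
  have hmr : ∀ {x}, x ∈ r :: rs → x ∈ (freeRan s).drop m := fun h => hr ▸ h
  have e1 : ((d :: ds).map fun d' => partialZeta f (extend s d' r) m) =
      (d :: ds).map fun d' => ∑ t, if t d' = some r then
        (if Admissible s m t then f t else 0) else 0 := by
    refine List.map_congr_left fun d' h => ?_
    rw [partialZeta_eq_sum_ite]
    refine Finset.sum_congr rfl fun t _ => ?_
    rw [← ite_and]
    exact if_congr ((admissible_extend (hmd h) (hmr List.mem_cons_self)).trans and_comm) rfl rfl
  have e2 : (rs.map fun r' => partialZeta f (extend s d r') m) =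
      rs.map fun r' => ∑ t, if t d = some r' then
        (if Admissible s m t then f t else 0) else 0 := by
    refine List.map_congr_left fun r' h => ?_
    rw [partialZeta_eq_sum_ite]
    refine Finset.sum_congr rfl fun t _ => ?_
    rw [← ite_and]
    exact if_congr ((admissible_extend (hmd List.mem_cons_self)
      (hmr (List.mem_cons_of_mem _ h))).trans and_comm) rfl rfl
  have e3 : (ds.map fun d' => (rs.map fun r' =>
      partialZeta f (extend (extend s d' r) d r') m).sum) =
      ds.map fun d' => ∑ t, if t d' = some r then
        (rs.map fun r' => if t d = some r' then
          (if Admissible s m t then f t else 0) else 0).sum else 0 := by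
    refine List.map_congr_left fun d' h => ?_
    have e : (rs.map fun r' => partialZeta f (extend (extend s d' r) d r') m) =
        rs.map fun r' => ∑ t, if t d' = some r then (if t d = some r' then
          (if Admissible s m t then f t else 0) else 0) else 0 := by
      refine List.map_congr_left fun r' h' => ?_
      rw [partialZeta_eq_sum_ite]
      refine Finset.sum_congr rfl fun t _ => ?_
      rw [← ite_and, ← ite_and]
      have hd' := hmd (List.mem_cons_of_mem _ h)
      have hr' := hmr (List.mem_cons_of_mem _ h')
      -- The second pair d → r' must still be free after d' → r has been added.
      have hne : d ≠ d' := fun h0 => (List.nodup_cons.1 hnd).1 (h0 ▸ h)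
      have hne' : r' ≠ r := fun h0 => (List.nodup_cons.1 hnr).1 (h0 ▸ h')
      refine if_congr ?_ rfl rfl
      rw [admissible_extend
        (mem_drop_freeDom_extend hd' (hmr List.mem_cons_self) (hmd List.mem_cons_self) hne)
        (mem_drop_freeRan_extend hd' (hmr List.mem_cons_self) hr' hne'),
        admissible_extend hd' (hmr List.mem_cons_self)]
      tauto
    rw [e, sum_map_sum_comm]
    refine Finset.sum_congr rfl fun t _ => ?_
    by_cases ht : t d' = some r <;> simp [ht]
  rw [e1, e2, e3, sum_map_sum_comm, sum_map_sum_comm, sum_map_sum_comm, partialZeta_eq_sum_ite,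
    partialZeta_eq_sum_ite, ← Finset.sum_add_distrib, ← Finset.sum_add_distrib,
    ← Finset.sum_sub_distrib]
  refine Finset.sum_congr rfl fun t _ => ?_
  have htd : (freeDom s).take (m + 1) = (freeDom s).take m ++ [d] := by
    rw [List.take_add, hd]; rfl
  have htr : (freeRan s).take (m + 1) = (freeRan s).take m ++ [r] := by
    rw [List.take_add, hr]; rfl
  have hadm : Admissible s (m + 1) t ↔ Admissible s m t ∧ d ∉ dom t ∧ r ∉ ran t := by
    simp only [Admissible, htd, htr, List.mem_append, List.mem_singleton, or_imp, forall_and,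
      forall_eq]
    tauto
  -- Every term has `Admissible s m t` as a factor, so other t contribute 0 to both sides.
  by_cases hA : Admissible s m t
  swap
  · simp [hadm, hA]
  rw [sum_map_ite_of_unique hnd fun a _ b _ h h' => apply_inj h h',
    sum_map_ite_of_unique hnr.of_cons fun a _ b _ h h' => Option.some.inj (h.symm.trans h'),
    sum_map_ite_of_unique hnd.of_cons fun a _ b _ h h' => apply_inj h h']
  -- A preimage of r under t is not in dom s, as r is free for s, and is not among the first m free
  -- points, by admissibility; so it lies in `d :: ds`.
  have hX : (∃ a ∈ d :: ds, t a = some r) ↔ r ∈ ran t := by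
    rw [mem_ran]
    refine ⟨fun ⟨a, _, h⟩ => ⟨a, h⟩, fun ⟨a, h⟩ => ⟨a, ?_, h⟩⟩
    have ha : a ∈ freeDom s := mem_freeDom.2 fun ha => by
      obtain ⟨y, hy⟩ := mem_dom.1 ha
      have := hA.1 a y hy
      rw [show t a = some y from this] at h
      rw [Option.some.inj h] at hy
      exact mem_freeRan.1 (List.mem_of_mem_drop (hmr List.mem_cons_self)) (mem_ran.2 ⟨a, hy⟩)
    rw [← List.take_append_drop m (freeDom s), hd] at ha
    exact (List.mem_append.1 ha).resolve_left fun h' => hA.2.1 a h' (mem_dom.2 ⟨r, h⟩)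
  have hY : (∃ a ∈ r :: rs, t d = some a) ↔ d ∈ dom t := by
    rw [mem_dom]
    refine ⟨fun ⟨a, _, h⟩ => ⟨a, h⟩, fun ⟨a, h⟩ => ⟨a, ?_, h⟩⟩
    have ha : a ∈ freeRan s := mem_freeRan.2 fun ha => by
      obtain ⟨x, hx⟩ := mem_ran.1 ha
      rw [apply_inj (hA.1 x a hx) h] at hx
      exact mem_freeDom.1 (List.mem_of_mem_drop (hmd List.mem_cons_self)) (mem_dom.2 ⟨a, hx⟩)
    rw [← List.take_append_drop m (freeRan s), hr] at ha
    exact (List.mem_append.1 ha).resolve_left fun h' => hA.2.2 a h' (mem_ran.2 ⟨d, h⟩)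
  have hr0 : r ∉ rs := (List.nodup_cons.1 hnr).1
  -- If t sends d to r, only the first single sum sees t; otherwise the identity is
  -- inclusion–exclusion for the events r ∈ ran t and d ∈ dom t.
  by_cases htdr : t d = some r
  · have h2 : r ∈ ran t := mem_ran.2 ⟨d, htdr⟩
    simp [hadm, h2, hA, htdr, hr0]
  · rw [← hX, ← hY] at hadm
    simp only [List.mem_cons, exists_eq_or_imp, htdr, false_or] at hadm ⊢
    by_cases h1 : ∃ a ∈ ds, t a = some r <;> by_cases h2 : ∃ a ∈ rs, t d = some a <;>
      simp only [hadm, hA, h1, h2, if_true, if_false] <;> simp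

/-! ### The number of elements of each rank -/

open Classical in
/-- An injection defined on `A`, as a partial injection. -/
noncomputable def ofEmbedding {A : Finset (Fin n)} (g : A ↪ Fin n) : Rook n where
  toFun x := if h : x ∈ A then some (g ⟨x, h⟩) else none
  invFun y := if h : ∃ a, g a = y then some h.choose else none
  inv x y := by
    constructor
    · intro h
      split_ifs at h with hy
      have hx := Option.some.inj h
      subst hx
      rw [dif_pos hy.choose.2]
      exact congrArg some hy.choose_spec
    · intro h
      split_ifs at h with hx
      have hy : ∃ a, g a = y := ⟨_, Option.some.inj h⟩
      rw [dif_pos hy, g.injective (hy.choose_spec.trans (Option.some.inj h).symm)]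

theorem ofEmbedding_apply_of_mem {A : Finset (Fin n)} (g : A ↪ Fin n) {x : Fin n} (h : x ∈ A) :
    ofEmbedding g x = some (g ⟨x, h⟩) :=
  dif_pos h

theorem dom_ofEmbedding {A : Finset (Fin n)} (g : A ↪ Fin n) : dom (ofEmbedding g) = A := by
  ext x
  by_cases h : x ∈ A
  · simp [h, mem_dom, ofEmbedding_apply_of_mem g h]
  · have h0 : ofEmbedding g x = none := dif_neg h
    simp [h, mem_dom, h0]

/-- Reduces the count by rank to counting embeddings of each k-element domain A, of which there are
n!/(n-k)! = k!·C(n,k) when k ≤ n. -/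
theorem ofEmbedding_bijective (A : Finset (Fin n)) :
    Function.Bijective fun g : A ↪ Fin n =>
      (⟨ofEmbedding g, dom_ofEmbedding g⟩ : {s : Rook n // dom s = A}) := by
  constructor
  · intro g g' h
    have h' : ofEmbedding g = ofEmbedding g' := congrArg Subtype.val h
    ext1 ⟨x, hx⟩
    have := ofEmbedding_apply_of_mem g hx
    rw [h', ofEmbedding_apply_of_mem g' hx] at this
    exact (Option.some.inj this).symm
  · rintro ⟨s, rfl⟩
    have hs : ∀ x : dom s, ∃ y, s x = some y := fun x => mem_dom.1 x.2
    choose g hg using hs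
    refine ⟨⟨g, fun x x' h => Subtype.ext (apply_inj (hg x) (h ▸ hg x'))⟩, Subtype.ext ?_⟩
    refine PEquiv.ext fun x => ?_
    by_cases hx : x ∈ dom s
    · exact (ofEmbedding_apply_of_mem _ hx).trans (hg ⟨x, hx⟩).symm
    · have h1 : s x = none := by simpa [dom] using hx
      exact (dif_neg hx).trans h1.symm

/-- The number of elements of rank `k`. -/
theorem card_rank_eq (n k : ℕ) :
    (Finset.univ.filter fun s : Rook n => rk s = k).card = n.choose k ^ 2 * k ! := by
  classical
  have h : (Finset.univ.filter fun s : Rook n => rk s = k) =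
      (Finset.powersetCard k Finset.univ).biUnion fun A =>
        Finset.univ.filter fun s : Rook n => dom s = A := by
    ext s
    simp only [Finset.mem_filter, Finset.mem_biUnion, Finset.mem_univ, true_and]
    simp [rk]
  rw [h, Finset.card_biUnion]
  · have h2 : ∀ A ∈ Finset.powersetCard k (Finset.univ : Finset (Fin n)),
        (Finset.univ.filter fun s : Rook n => dom s = A).card = k ! * n.choose k := by
      intro A hA
      rw [← Fintype.card_subtype, ← Fintype.card_of_bijective (ofEmbedding_bijective A),
        Fintype.card_embedding_eq]
      simp [(Finset.mem_powersetCard.1 hA).2, Nat.descFactorial_eq_factorial_mul_choose]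
    rw [Finset.sum_congr rfl h2]
    simp
    ring
  · intro A _ B _ hAB
    rw [Function.onFun, Finset.disjoint_left]
    intro s hs hs'
    exact hAB (by simpa using (Finset.mem_filter.1 hs).2.symm.trans (Finset.mem_filter.1 hs').2)

theorem card_rook (n : ℕ) :
    Fintype.card (Rook n) = ∑ k ∈ Finset.range (n + 1), n.choose k ^ 2 * k ! := by
  rw [← Finset.card_univ, Finset.card_eq_sum_card_fiberwise (f := rk) (t := Finset.range (n + 1))]
  · exact Finset.sum_congr rfl fun k _ => card_rank_eq n k
  · intro s _
    have := rk_le s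
    simp
    omega

/-! ### The estimate -/

/-- The number of elements of rank `n - j`. -/
def corankCount (n j : ℕ) : ℕ := n.choose j ^ 2 * (n - j)!

theorem card_rook_eq_sum_corankCount (n : ℕ) :
    Fintype.card (Rook n) = ∑ j ∈ Finset.range (n + 1), corankCount n j := by
  rw [card_rook, ← Finset.sum_range_reflect]
  refine Finset.sum_congr rfl fun j hj => ?_
  have := Finset.mem_range.1 hj
  rw [corankCount, show n + 1 - 1 - j = n - j by omega, Nat.choose_symm (by omega)]

/-- The ratio of consecutive counts, with denominators cleared to stay in ℕ. For j ≥ n both sides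
vanish. -/
theorem corankCount_succ (n j : ℕ) :
    corankCount n (j + 1) * (j + 1) ^ 2 = corankCount n j * (n - j) := by
  rcases lt_or_ge j n with h | h
  · have h1 := Nat.choose_succ_right_eq n j
    obtain ⟨k, rfl⟩ : ∃ k, n = j + k + 1 := ⟨n - j - 1, by omega⟩
    rw [show j + k + 1 - j = k + 1 by omega] at h1
    rw [corankCount, corankCount, show j + k + 1 - (j + 1) = k by omega,
      show j + k + 1 - j = k + 1 by omega, Nat.factorial_succ]
    calc _ = ((j + k + 1).choose (j + 1) * (j + 1)) ^ 2 * k ! := by ring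
      _ = _ := by rw [h1]; ring
  · rw [corankCount, Nat.choose_eq_zero_of_lt (by omega), Nat.sub_eq_zero_of_le h]
    simp

/-- Beyond the peak, `(j - 1) * corankCount n j` decreases. -/
theorem mul_corankCount_succ_le {n j : ℕ} (h : n ≤ j ^ 2) :
    j * corankCount n (j + 1) ≤ (j - 1) * corankCount n j := by
  rcases j with _ | j
  · simp
  refine Nat.le_of_mul_le_mul_right ?_ (show 0 < (j + 1 + 1) ^ 2 by positivity)
  -- With j shifted by one, n ≤ (j+1)² gives n - (j+1) ≤ j(j+1), and (j+1)·j(j+1) ≤ j(j+2)².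
  have h1 : (j + 1) * (n - (j + 1)) ≤ j * (j + 1 + 1) ^ 2 := by
    have : n - (j + 1) ≤ j ^ 2 + j := by
      rw [Nat.sub_le_iff_le_add]
      nlinarith
    nlinarith [Nat.mul_le_mul_left (j + 1) this]
  calc (j + 1) * corankCount n (j + 1 + 1) * (j + 1 + 1) ^ 2
      = (j + 1) * (n - (j + 1)) * corankCount n (j + 1) := by
        rw [mul_assoc, corankCount_succ]; ring
    _ ≤ j * (j + 1 + 1) ^ 2 * corankCount n (j + 1) := Nat.mul_le_mul_right _ h1
    _ = _ := by rw [Nat.add_sub_cancel]; ring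

/-- Hence its maximum is attained at some `i ≤ √n + 1`. -/
theorem exists_mul_corankCount_le (n j : ℕ) :
    ∃ i, (i - 1) ^ 2 ≤ n ∧ (j - 1) * corankCount n j ≤ (i - 1) * corankCount n i := by
  induction j with
  | zero => exact ⟨0, by simp, le_rfl⟩
  | succ j ih =>
    rcases le_or_gt ((j + 1 - 1) ^ 2) n with h | h
    · exact ⟨j + 1, h, le_rfl⟩
    · obtain ⟨i, hi, hle⟩ := ih
      exact ⟨i, hi, (mul_corankCount_succ_le h.le).trans hle⟩

theorem corankCount_le_card_rook (n j : ℕ) : corankCount n j ≤ Fintype.card (Rook n) := by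
  rcases lt_or_ge n j with h | h
  · simp [corankCount, Nat.choose_eq_zero_of_lt h]
  · rw [card_rook_eq_sum_corankCount]
    exact Finset.single_le_sum (f := corankCount n) (fun _ _ => Nat.zero_le _)
      (Finset.mem_range.2 (by omega))

/-- Near the peak, the numbers of elements of consecutive ranks are almost equal. -/
theorem corankCount_le_mul_succ {n J : ℕ} {x : ℝ} (hx : 4 ≤ x) (hn : x ^ 4 = n)
    (hJ : (J : ℝ) ≤ x ^ 2 + x) :
    (corankCount n J : ℝ) ≤ Real.exp (4 / x) * corankCount n (J + 1) := by
  have hx2 : 4 * x ≤ x ^ 2 := by nlinarith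
  have hx3 : 4 * x ^ 2 ≤ x ^ 3 := by nlinarith [sq_nonneg x]
  have hx4 : 4 * x ^ 3 ≤ x ^ 4 := by nlinarith [pow_pos (show (0 : ℝ) < x by linarith) 3]
  have hJn : (J : ℝ) < n := by rw [← hn]; linarith
  have hrec : (corankCount n (J + 1) : ℝ) * ((J : ℝ) + 1) ^ 2 = corankCount n J * (n - J) := by
    have := corankCount_succ n J
    have hc : J ≤ n := by exact_mod_cast hJn.le
    rw [← Nat.cast_sub hc]
    exact_mod_cast this
  have hstep : ((J : ℝ) + 1) ^ 2 ≤ Real.exp (4 / x) * (n - J) := by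
    have h1 : ((J : ℝ) + 1) ^ 2 ≤ (x ^ 2 + x + 1) ^ 2 := by gcongr
    have h2 : x ^ 4 - x ^ 2 - x ≤ (n : ℝ) - J := by rw [← hn]; linarith
    have h3 : 4 / x + 1 ≤ Real.exp (4 / x) := Real.add_one_le_exp _
    have h4 : (4 / x + 1) * (x ^ 4 - x ^ 2 - x) = 4 * x ^ 3 - 4 * x - 4 + x ^ 4 - x ^ 2 - x := by
      field_simp
      ring
    have h5 : (x ^ 2 + x + 1) ^ 2 ≤ (4 / x + 1) * (x ^ 4 - x ^ 2 - x) := by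
      rw [h4]; nlinarith
    refine h1.trans (h5.trans ?_)
    refine mul_le_mul h3 h2 (by linarith) (Real.exp_pos _).le
  have hpos : (0 : ℝ) < n - J := by linarith
  refine le_of_mul_le_mul_right ?_ hpos
  rw [← hrec]
  calc (corankCount n (J + 1) : ℝ) * ((J : ℝ) + 1) ^ 2
      ≤ corankCount n (J + 1) * (Real.exp (4 / x) * (n - J)) := by gcongr
    _ = _ := by ring

theorem mul_corankCount_le_of_sq_le {n i : ℕ} {x : ℝ} (hx : 0 ≤ x) (hn : x ^ 4 = n)
    (hi : (i - 1) ^ 2 ≤ n) :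
    (((i - 1) * corankCount n i : ℕ) : ℝ) ≤ Real.exp 4 * (x * Fintype.card (Rook n)) := by
  have hi' : ((i - 1 : ℕ) : ℝ) ≤ x ^ 2 := by
    refine le_of_sq_le_sq ?_ (by positivity)
    calc ((i - 1 : ℕ) : ℝ) ^ 2 ≤ n := by exact_mod_cast hi
      _ = (x ^ 2) ^ 2 := by rw [← hn]; ring
  rw [Nat.cast_mul]
  rcases lt_or_ge x 4 with h4 | h4
  · have h1 : (corankCount n i : ℝ) ≤ Fintype.card (Rook n) := by
      exact_mod_cast corankCount_le_card_rook n i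
    have h2 : (4 : ℝ) ≤ Real.exp 4 := by linarith [Real.add_one_le_exp (4 : ℝ)]
    calc ((i - 1 : ℕ) : ℝ) * corankCount n i ≤ x ^ 2 * Fintype.card (Rook n) := by gcongr
      _ = x * (x * Fintype.card (Rook n)) := by ring
      _ ≤ _ := by gcongr; linarith
  have hi1 : (i : ℝ) ≤ x ^ 2 + 1 := by
    have : i ≤ i - 1 + 1 := by omega
    calc (i : ℝ) ≤ ((i - 1 + 1 : ℕ) : ℝ) := by exact_mod_cast this
      _ ≤ _ := by push_cast; linarith
  have hq : (⌊x⌋₊ : ℝ) ≤ x := Nat.floor_le hx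
  -- The steps use J = i + t with i ≤ x² + 1 and t + 1 ≤ x, which is the range J ≤ x² + x. At most x
  -- factors e^{4/x} accumulate to e⁴.
  have hchain : ∀ t ≤ ⌊x⌋₊, (corankCount n i : ℝ) ≤
      Real.exp (4 / x * t) * corankCount n (i + t) := by
    intro t
    induction t with
    | zero => simp
    | succ t ih =>
      intro ht
      have ht' : (t : ℝ) + 1 ≤ x := by
        refine le_trans ?_ hq
        exact_mod_cast ht
      refine (ih (by omega)).trans ?_
      rw [Nat.cast_succ, mul_add, mul_one, Real.exp_add, mul_assoc]
      gcongr
      exact corankCount_le_mul_succ h4 hn (by push_cast; linarith)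
  have hx0 : 0 < x := by linarith
  have hle : ∀ t ∈ Finset.range (⌊x⌋₊ + 1), (corankCount n i : ℝ) ≤
      Real.exp 4 * corankCount n (i + t) := by
    intro t ht
    have ht' : t ≤ ⌊x⌋₊ := by simpa [Nat.lt_succ_iff] using ht
    refine (hchain t ht').trans ?_
    gcongr
    have : (t : ℝ) ≤ x := le_trans (by exact_mod_cast ht') hq
    calc 4 / x * t ≤ 4 / x * x := by gcongr
      _ = 4 := by field_simp
  have hin : i + ⌊x⌋₊ ≤ n := by
    have : (i : ℝ) + ⌊x⌋₊ ≤ n := by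
      rw [← hn]
      nlinarith [sq_nonneg (x ^ 2 - 4)]
    exact_mod_cast this
  have hsum : ((⌊x⌋₊ : ℝ) + 1) * corankCount n i ≤ Real.exp 4 * Fintype.card (Rook n) := by
    calc ((⌊x⌋₊ : ℝ) + 1) * corankCount n i
        = ∑ t ∈ Finset.range (⌊x⌋₊ + 1), (corankCount n i : ℝ) := by simp
      _ ≤ ∑ t ∈ Finset.range (⌊x⌋₊ + 1), Real.exp 4 * corankCount n (i + t) :=
        Finset.sum_le_sum hle
      _ = Real.exp 4 * ((∑ t ∈ Finset.range (⌊x⌋₊ + 1), corankCount n (i + t) : ℕ) : ℝ) := by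
        rw [← Finset.mul_sum]; push_cast; rfl
      _ ≤ _ := by
        gcongr
        have h := Finset.sum_Ico_eq_sum_range (corankCount n) i (i + (⌊x⌋₊ + 1))
        rw [Nat.add_sub_cancel_left] at h
        rw [card_rook_eq_sum_corankCount, ← h]
        exact Finset.sum_le_sum_of_subset fun j hj => by
          rw [Finset.mem_Ico] at hj
          rw [Finset.mem_range]
          omega
  calc ((i - 1 : ℕ) : ℝ) * corankCount n i ≤ x ^ 2 * corankCount n i := by gcongr
    _ = x * (x * corankCount n i) := by ring
    _ ≤ x * ((⌊x⌋₊ + 1) * corankCount n i) := by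
      gcongr
      exact (Nat.lt_floor_add_one x).le
    _ ≤ x * (Real.exp 4 * Fintype.card (Rook n)) := by gcongr
    _ = _ := by ring

/-- The largest number of work cells allocated in a single step. -/
def maxWork (n : ℕ) : ℕ := (Finset.range n).sup fun k => (n - k - 1) * n.choose k ^ 2 * k !

/-- The case k ≥ n is needed too, since `stepCells` involves ranks beyond n; there the first factor
is 0. -/
theorem work_le_maxWork (n k : ℕ) : (n - k - 1) * n.choose k ^ 2 * k ! ≤ maxWork n := by
  rcases lt_or_ge k n with h | h
  · exact Finset.le_sup (f := fun k => (n - k - 1) * n.choose k ^ 2 * k !) (Finset.mem_range.2 h)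
  · simp [Nat.sub_eq_zero_of_le h]

theorem maxWork_le (n : ℕ) :
    (maxWork n : ℝ) ≤ Real.exp 4 * ((n : ℝ) ^ (1 / 4 : ℝ) * Fintype.card (Rook n)) := by
  have hx : ((n : ℝ) ^ (1 / 4 : ℝ)) ^ 4 = n := by
    rw [← Real.rpow_natCast, ← Real.rpow_mul (by positivity)]
    norm_num
  -- Rounding the real bound down makes it a natural number, so that the supremum can be bounded
  -- termwise in ℕ.
  refine le_trans ?_ (Nat.floor_le (by positivity))
  rw [Nat.cast_le]
  refine Finset.sup_le fun k hk => Nat.le_floor ?_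
  have hk' := Finset.mem_range.1 hk
  obtain ⟨i, hi, hle⟩ := exists_mul_corankCount_le n (n - k)
  refine le_trans (Nat.cast_le.2 ?_) (mul_corankCount_le_of_sq_le (by positivity) hx hi)
  refine le_trans (le_of_eq ?_) hle
  rw [corankCount, Nat.choose_symm hk'.le, Nat.sub_sub_self hk'.le, mul_assoc]

/-! ### Executions in bounded space -/

/-- The program runs from the first memory to the second one, and at every point of the execution
at most `B` cells are held. -/
inductive Exec (B : ℕ) : List (Instr n) → Memory n → Memory n → Prop
  | nil {M : Memory n} (h : M.cells.card ≤ B) : Exec B [] M M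
  | cons {i : Instr n} {p : List (Instr n)} {M M' M'' : Memory n} (h : M.cells.card ≤ B)
      (hi : i.exec M = some M') (hp : Exec B p M' M'') : Exec B (i :: p) M M''

namespace Exec

variable {B : ℕ} {p q : List (Instr n)} {M M' M'' : Memory n}

theorem append (hp : Exec B p M M') (hq : Exec B q M' M'') : Exec B (p ++ q) M M'' := by
  induction hp with
  | nil _ => exact hq
  | cons h hi _ ih => exact cons h hi (ih hq)

theorem run_eq (hp : Exec B p M M') : run p M = some M' := by
  induction hp with
  | nil _ => rfl
  | cons h hi _ ih =>
    rw [run, List.foldlM_cons, hi]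
    exact ih

/-- The prefixes of a program are the points of its execution. -/
theorem exists_of_prefix (hp : Exec B p M M') (hq : q <+: p) :
    ∃ N, run q M = some N ∧ N.cells.card ≤ B := by
  induction hp generalizing q with
  | nil h =>
    rw [List.prefix_nil.1 hq]
    exact ⟨_, rfl, h⟩
  | cons h hi _ ih =>
    rcases List.prefix_cons_iff.1 hq with rfl | ⟨q', rfl, hq'⟩
    · exact ⟨_, rfl, h⟩
    · obtain ⟨N, hN, hB⟩ := ih hq'
      refine ⟨N, ?_, hB⟩
      rw [run, List.foldlM_cons, hi]
      exact hN

end Exec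

section Accumulate

variable {B : ℕ} {C : Finset (Cell n)} {V : Cell n → ℂ} {dst : Cell n}

theorem exec_copy (hB : C.card ≤ B) (hdst : dst ∈ C) {src : Cell n} (hsrc : src ∈ C) :
    Exec B [.copy dst src] ⟨C, V⟩ ⟨C, Function.update V dst (V src)⟩ :=
  .cons hB (if_pos ⟨hdst, hsrc⟩) (.nil hB)

/-- The state has the form `Function.update V dst x` throughout: the sources differ from `dst`, so
they are always read from the unchanged `V`, while x accumulates. -/
theorem exec_adds {ι : Type*} (hB : C.card ≤ B) (hdst : dst ∈ C) {g : ι → Cell n} {v : ι → ℂ}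
    (l : List ι) (hl : ∀ a ∈ l, g a ∈ C ∧ g a ≠ dst ∧ V (g a) = v a) (x : ℂ) :
    Exec B (l.map fun a => .add dst (g a)) ⟨C, Function.update V dst x⟩
      ⟨C, Function.update V dst (x + (l.map v).sum)⟩ := by
  induction l generalizing x with
  | nil => simpa using Exec.nil (M := ⟨C, Function.update V dst x⟩) hB
  | cons a l ih =>
    obtain ⟨h1, h2, h3⟩ := hl a List.mem_cons_self
    refine .cons hB (if_pos ⟨hdst, h1⟩) ?_
    dsimp only
    rw [Function.update_self, Function.update_of_ne h2, h3, Function.update_idem, List.map_cons,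
      List.sum_cons, ← add_assoc]
    exact ih (fun b hb => hl b (List.mem_cons_of_mem _ hb)) _

theorem exec_subs {ι : Type*} (hB : C.card ≤ B) (hdst : dst ∈ C) {g : ι → Cell n} {v : ι → ℂ}
    (l : List ι) (hl : ∀ a ∈ l, g a ∈ C ∧ g a ≠ dst ∧ V (g a) = v a) (x : ℂ) :
    Exec B (l.map fun a => .sub dst (g a)) ⟨C, Function.update V dst x⟩
      ⟨C, Function.update V dst (x - (l.map v).sum)⟩ := by
  induction l generalizing x with
  | nil => simpa using Exec.nil (M := ⟨C, Function.update V dst x⟩) hB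
  | cons a l ih =>
    obtain ⟨h1, h2, h3⟩ := hl a List.mem_cons_self
    refine .cons hB (if_pos ⟨hdst, h1⟩) ?_
    dsimp only
    rw [Function.update_self, Function.update_of_ne h2, h3, Function.update_idem, List.map_cons,
      List.sum_cons, ← sub_sub]
    exact ih (fun b hb => hl b (List.mem_cons_of_mem _ hb)) _

theorem exec_subs_flatMap {ι κ : Type*} (hB : C.card ≤ B) (hdst : dst ∈ C) {g : ι → κ → Cell n}
    {v : ι → κ → ℂ} (l : List ι) (l' : List κ)
    (hl : ∀ a ∈ l, ∀ b ∈ l', g a b ∈ C ∧ g a b ≠ dst ∧ V (g a b) = v a b) (x : ℂ) :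
    Exec B (l.flatMap fun a => l'.map fun b => .sub dst (g a b)) ⟨C, Function.update V dst x⟩
      ⟨C, Function.update V dst (x - (l.map fun a => (l'.map (v a)).sum).sum)⟩ := by
  induction l generalizing x with
  | nil => simpa using Exec.nil (M := ⟨C, Function.update V dst x⟩) hB
  | cons a l ih =>
    rw [List.flatMap_cons, List.map_cons, List.sum_cons, ← sub_sub]
    exact (exec_subs hB hdst l' (hl a List.mem_cons_self) x).append
      (ih (fun b hb => hl b (List.mem_cons_of_mem _ hb)) _)

end Accumulate

theorem exec_frees {B : ℕ} (l : List (Cell n)) (hl : l.Nodup) (M : Memory n)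
    (hM : ∀ c ∈ l, c ∈ M.cells) (hB : M.cells.card ≤ B) :
    Exec B (l.map .free) M ⟨M.cells \ l.toFinset, M.val⟩ := by
  induction l generalizing M with
  | nil => simpa using Exec.nil hB
  | cons c l ih =>
    rw [List.nodup_cons] at hl
    refine .cons hB (if_pos (hM c List.mem_cons_self)) ?_
    have h := ih hl.2 ⟨M.cells.erase c, M.val⟩ (fun b hb => Finset.mem_erase.2
      ⟨fun h => hl.1 (h ▸ hb), hM b (List.mem_cons_of_mem _ hb)⟩)
      ((Finset.card_le_card (Finset.erase_subset _ _)).trans hB)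
    convert h using 2
    ext b
    simp only [Finset.mem_sdiff, List.mem_toFinset, List.mem_cons, Finset.mem_erase]
    tauto

theorem exec_allocs {B : ℕ} (l : List (Cell n)) (hl : l.Nodup) (M : Memory n)
    (hM : ∀ c ∈ l, c ∉ M.cells) (hB : (M.cells ∪ l.toFinset).card ≤ B) :
    ∃ V : Cell n → ℂ, Exec B (l.map .alloc) M ⟨M.cells ∪ l.toFinset, V⟩ ∧
      ∀ c, c ∉ l → V c = M.val c := by
  have hB' : M.cells.card ≤ B := (Finset.card_le_card Finset.subset_union_left).trans hB
  induction l generalizing M with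
  | nil => exact ⟨M.val, by simpa using Exec.nil hB', fun _ _ => rfl⟩
  | cons c l ih =>
    rw [List.nodup_cons] at hl
    have hcells : insert c M.cells ∪ l.toFinset = M.cells ∪ (c :: l).toFinset := by
      ext b
      simp only [Finset.mem_union, List.mem_toFinset, List.mem_cons, Finset.mem_insert]
      tauto
    have hB2 : (insert c M.cells ∪ l.toFinset).card ≤ B := hcells ▸ hB
    obtain ⟨V, hV, hVM⟩ := ih hl.2 ⟨insert c M.cells, Function.update M.val c 0⟩ (fun b hb h => by
      rcases Finset.mem_insert.1 h with rfl | h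
      · exact hl.1 hb
      · exact hM b (List.mem_cons_of_mem _ hb) h) hB2
      ((Finset.card_le_card Finset.subset_union_left).trans hB2)
    refine ⟨V, .cons hB' (if_neg (hM c List.mem_cons_self)) (hcells ▸ hV), fun b hb => ?_⟩
    rw [List.mem_cons, not_or] at hb
    rw [hVM b hb.2]
    exact Function.update_of_ne hb.1 _ _

/-! ### The computation at one element -/

/-- Different partial transforms never share a cell, so writing one cannot destroy another. -/
theorem loc_inj {s s' : Rook n} {m m' : ℕ} (h : loc s m = loc s' m') : s = s' ∧ m = m' := by
  unfold loc at h
  split_ifs at h <;> cases h <;> simp_all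

/-- The memory holds all partial zeta transforms at `s`. -/
def Holds (f : Rook n → ℂ) (V : Cell n → ℂ) (s : Rook n) : Prop :=
  (∀ m ≤ n - rk s, V (loc s m) = partialZeta f s m) ∧ V (.output s) = zeta f s

theorem exec_computePartial {B : ℕ} {f : Rook n → ℂ} {s : Rook n} {m : ℕ} (hm : m < n - rk s)
    {C : Finset (Cell n)} {V : Cell n → ℂ} (hB : C.card ≤ B)
    (hC : ∀ s', rk s ≤ rk s' → rk s' ≤ rk s + 2 → ∀ i ≤ n - rk s', loc s' i ∈ C)
    (hV : ∀ s', rk s < rk s' → Holds f V s')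
    (hs : V (loc s (m + 1)) = partialZeta f s (m + 1)) :
    Exec B (computePartial s m) ⟨C, V⟩ ⟨C, Function.update V (loc s m) (partialZeta f s m)⟩ := by
  have hld : ((freeDom s).drop m).length = n - rk s - m := by
    rw [List.length_drop, length_freeDom]
  have hlr : ((freeRan s).drop m).length = n - rk s - m := by
    rw [List.length_drop, length_freeRan]
  unfold computePartial
  rcases hd : (freeDom s).drop m with _ | ⟨d, ds⟩
  · rw [hd] at hld; simp at hld; omega
  rcases hr : (freeRan s).drop m with _ | ⟨r, rs⟩
  · rw [hr] at hlr; simp at hlr; omega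
  have hnd : (d :: ds).Nodup := hd ▸ (nodup_freeDom s).drop
  have hnr : (r :: rs).Nodup := hr ▸ (nodup_freeRan s).drop
  have hmd : ∀ {x}, x ∈ d :: ds → x ∈ (freeDom s).drop m := fun h => hd ▸ h
  have hmr : ∀ {x}, x ∈ r :: rs → x ∈ (freeRan s).drop m := fun h => hr ▸ h
  have hdom : ∀ {s' : Rook n} {x}, x ∈ (freeDom s').drop m → x ∉ dom s' :=
    fun h => mem_freeDom.1 (List.mem_of_mem_drop h)
  have hran : ∀ {s' : Rook n} {x}, x ∈ (freeRan s').drop m → x ∉ ran s' :=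
    fun h => mem_freeRan.1 (List.mem_of_mem_drop h)
  have hsrc : ∀ s', rk s < rk s' → rk s' ≤ rk s + 2 → m ≤ n - rk s' →
      loc s' m ∈ C ∧ loc s' m ≠ loc s m ∧ V (loc s' m) = partialZeta f s' m := by
    intro s' h1 h2 h3
    refine ⟨hC s' h1.le h2 m h3, fun h => ?_, (hV s' h1).1 m h3⟩
    rw [(loc_inj h).1] at h1
    exact lt_irrefl _ h1
  have hdst : loc s m ∈ C := hC s le_rfl (by omega) m hm.le
  dsimp only
  rw [partialZeta_recurrence f hd hr, ← hs]
  refine (((exec_copy hB hdst (hC s le_rfl (by omega) (m + 1) (by omega))).append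
    (exec_adds hB hdst _ ?_ _)).append (exec_adds hB hdst _ ?_ _)).append
    (exec_subs_flatMap hB hdst _ _ ?_ _)
  · intro d' h
    have := rk_extend (hdom (hmd h)) (hran (hmr List.mem_cons_self))
    exact hsrc _ (by omega) (by omega) (by omega)
  · intro r' h
    have := rk_extend (hdom (hmd List.mem_cons_self)) (hran (hmr (List.mem_cons_of_mem _ h)))
    exact hsrc _ (by omega) (by omega) (by omega)
  · intro d' h r' h'
    have hd' := hmd (List.mem_cons_of_mem _ h)
    have hne : d ≠ d' := fun h0 => (List.nodup_cons.1 hnd).1 (h0 ▸ h)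
    have hne' : r' ≠ r := fun h0 => (List.nodup_cons.1 hnr).1 (h0 ▸ h')
    have h1 := rk_extend (hdom hd') (hran (hmr List.mem_cons_self))
    have h2 := rk_extend
      (hdom (mem_drop_freeDom_extend hd' (hmr List.mem_cons_self) (hmd List.mem_cons_self) hne))
      (hran (mem_drop_freeRan_extend hd' (hmr List.mem_cons_self)
        (hmr (List.mem_cons_of_mem _ h')) hne'))
    -- A double term exists only if there is a free point after d; then m ≤ n - (rk s + 2), so index
    -- m makes sense at rank rk s + 2.
    have h3 : 0 < ds.length := List.length_pos_of_mem h
    rw [hd, List.length_cons] at hld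
    exact hsrc _ (by omega) (by omega) (by omega)

/-- Indices from j upwards are already done. The induction peels off j - 1, the head of the reversed
range, and tracks which cells may change. -/
theorem exec_computePartials {B : ℕ} {f : Rook n → ℂ} {s : Rook n} {j : ℕ} (hj : j ≤ n - rk s)
    {C : Finset (Cell n)} {V : Cell n → ℂ} (hB : C.card ≤ B)
    (hC : ∀ s', rk s ≤ rk s' → rk s' ≤ rk s + 2 → ∀ i ≤ n - rk s', loc s' i ∈ C)
    (hV : ∀ s', rk s < rk s' → Holds f V s')
    (hs : ∀ i, j ≤ i → i ≤ n - rk s → V (loc s i) = partialZeta f s i) :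
    ∃ V', Exec B ((List.range j).reverse.flatMap (computePartial s)) ⟨C, V⟩ ⟨C, V'⟩ ∧
      (∀ c, (∀ i < j, c ≠ loc s i) → V' c = V c) ∧
      ∀ i ≤ n - rk s, V' (loc s i) = partialZeta f s i := by
  induction j generalizing V with
  | zero => exact ⟨V, .nil hB, fun _ _ => rfl, fun i hi => hs i (Nat.zero_le i) hi⟩
  | succ j ih =>
    have hV₁ : ∀ s', rk s < rk s' →
        Holds f (Function.update V (loc s j) (partialZeta f s j)) s' := by
      intro s' h
      have hne : s' ≠ s := fun h0 => lt_irrefl _ (h0 ▸ h)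
      refine ⟨fun m hm => ?_, ?_⟩
      · rw [Function.update_of_ne fun h0 => hne (loc_inj h0).1, (hV s' h).1 m hm]
      · rw [Function.update_of_ne, (hV s' h).2]
        intro h0
        unfold loc at h0
        split_ifs at h0
        exact hne (by cases h0; rfl)
    have hs₁ : ∀ i, j ≤ i → i ≤ n - rk s →
        Function.update V (loc s j) (partialZeta f s j) (loc s i) = partialZeta f s i := by
      intro i h1 h2
      rcases eq_or_ne i j with rfl | hne
      · rw [Function.update_self]
      · rw [Function.update_of_ne fun h0 => hne (loc_inj h0).2, hs i (by omega) h2]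
    obtain ⟨V', hE, hF, hR⟩ := ih (by omega) hV₁ hs₁
    refine ⟨V', ?_, fun c hc => ?_, hR⟩
    · rw [List.range_succ, List.reverse_append]
      exact (exec_computePartial (by omega) hB hC hV (hs _ le_rfl hj)).append hE
    · rw [hF c fun i hi => hc i (by omega), Function.update_of_ne (hc j (by omega))]

theorem exec_computeAll {B : ℕ} {f : Rook n → ℂ} {s : Rook n}
    {C : Finset (Cell n)} {V : Cell n → ℂ} (hB : C.card ≤ B)
    (hC : ∀ s', rk s ≤ rk s' → rk s' ≤ rk s + 2 → ∀ i ≤ n - rk s', loc s' i ∈ C)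
    (hout : ∀ s', Cell.output s' ∈ C) (hin : ∀ s', V (.input s') = f s')
    (hV : ∀ s', rk s < rk s' → Holds f V s') :
    ∃ V', Exec B (computeAll s) ⟨C, V⟩ ⟨C, V'⟩ ∧ (∀ s', V' (.input s') = f s') ∧ Holds f V' s ∧
      ∀ s', Holds f V s' → Holds f V' s' := by
  have hcor : ∀ s' : Rook n, loc s' (n - rk s') = .input s' := fun s' => if_pos rfl
  -- Only cells of s are written, and never its input cell, which has index `n - rk s`; the rest
  -- follows from `loc_inj`.
  suffices h : ∃ V', Exec B (computeAll s) ⟨C, V⟩ ⟨C, V'⟩ ∧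
      (∀ c, (∀ i < n - rk s, c ≠ loc s i) → c ≠ .output s → V' c = V c) ∧ Holds f V' s by
    obtain ⟨V', hE, hF, hH⟩ := h
    refine ⟨V', hE, fun s' => ?_, hH, fun s' hs' => ?_⟩
    · rw [hF _ (fun i hi h0 => ?_) (by simp), hin]
      rw [← hcor] at h0
      obtain ⟨rfl, rfl⟩ := loc_inj h0
      exact lt_irrefl _ hi
    · by_cases hne : s' = s
      · rwa [hne]
      have hne2 : ∀ i m, loc s' i ≠ loc s m := fun i m h0 => hne (loc_inj h0).1
      refine ⟨fun m hm => ?_, ?_⟩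
      · rw [hF _ (fun i _ => hne2 m i) ?_, hs'.1 m hm]
        intro h0
        unfold loc at h0
        split_ifs at h0
        exact hne (by cases h0; rfl)
      · rw [hF _ (fun i _ h0 => ?_) (by simpa using hne), hs'.2]
        unfold loc at h0
        split_ifs at h0
        exact hne (by cases h0; rfl)
  unfold computeAll
  split_ifs with hn
  -- At rank n the index 0 is located at the input cell, so the output is not a `loc` cell; hence
  -- the separate output clause in `Holds`.
  · have h0 : n - rk s = 0 := by omega
    have hloc : loc s 0 = .input s := h0 ▸ hcor s
    have hpz : partialZeta f s 0 = f s := h0 ▸ partialZeta_corank f s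
    refine ⟨_, exec_copy hB (hout s) (hloc ▸ hC s le_rfl (by omega) 0 (by omega)),
      fun c _ hc => Function.update_of_ne hc _ _, fun m hm => ?_, ?_⟩
    · obtain rfl : m = 0 := by omega
      rw [hloc, Function.update_of_ne (by simp), hin, hpz]
    · rw [Function.update_self, hin, ← partialZeta_zero, hpz]
  · have hlt : rk s < n := lt_of_le_of_ne (rk_le s) hn
    obtain ⟨V', hE, hF, hR⟩ := exec_computePartials (le_refl (n - rk s)) hB hC hV
      fun i h1 h2 => by rw [le_antisymm h2 h1, hcor, hin, partialZeta_corank]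
    refine ⟨V', hE, fun c hc _ => hF c hc, hR, ?_⟩
    have hloc : loc s 0 = .output s := by
      rw [loc, if_neg (by omega), if_pos rfl]
    rw [← hloc, hR 0 (Nat.zero_le _), partialZeta_zero]

/-- Elements of equal rank do not use each other's values, so the order of the list is irrelevant.
-/
theorem exec_computeAll_flatMap {B k : ℕ} {f : Rook n → ℂ} (l : List (Rook n))
    (hl : ∀ s ∈ l, rk s = k) {C : Finset (Cell n)} {V : Cell n → ℂ} (hB : C.card ≤ B)
    (hC : ∀ s', k ≤ rk s' → rk s' ≤ k + 2 → ∀ i ≤ n - rk s', loc s' i ∈ C)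
    (hout : ∀ s', Cell.output s' ∈ C) (hin : ∀ s', V (.input s') = f s')
    (hV : ∀ s', k < rk s' → Holds f V s') :
    ∃ V', Exec B (l.flatMap computeAll) ⟨C, V⟩ ⟨C, V'⟩ ∧ (∀ s', V' (.input s') = f s') ∧
      (∀ s ∈ l, Holds f V' s) ∧ ∀ s', Holds f V s' → Holds f V' s' := by
  induction l generalizing V with
  | nil => exact ⟨V, .nil hB, hin, by simp, fun _ h => h⟩
  | cons s l ih =>
    have hs := hl s List.mem_cons_self
    obtain ⟨V₁, hE₁, hin₁, hs₁, hH₁⟩ :=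
      exec_computeAll (s := s) hB (hs.symm ▸ hC) hout hin (hs.symm ▸ hV)
    obtain ⟨V₂, hE₂, hin₂, hl₂, hH₂⟩ := ih (fun s' h => hl s' (List.mem_cons_of_mem _ h)) hin₁
      fun s' h => hH₁ s' (hV s' h)
    refine ⟨V₂, hE₁.append hE₂, hin₂, fun s' h => ?_, fun s' h => hH₂ s' (hH₁ s' h)⟩
    rcases List.mem_cons.1 h with rfl | h
    · exact hH₂ _ hs₁
    · exact hl₂ s' h

/-! ### The steps -/

theorem mem_elemsOfRank {k : ℕ} {s : Rook n} : s ∈ elemsOfRank n k ↔ rk s = k := by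
  simp [elemsOfRank]

theorem work_mem_workCells {k m : ℕ} {s : Rook n} :
    Cell.work s m ∈ workCells n k ↔ rk s = k ∧ 1 ≤ m ∧ m < n - k := by
  simp only [workCells, List.mem_flatMap, mem_elemsOfRank, List.mem_map, List.mem_range'_1,
    Cell.work.injEq]
  constructor
  · rintro ⟨s', hs', m', hm', rfl, rfl⟩
    exact ⟨hs', hm'.1, by omega⟩
  · rintro ⟨hs, h1, h2⟩
    exact ⟨s, hs, m, ⟨h1, by omega⟩, rfl, rfl⟩

theorem input_notMem_workCells {k : ℕ} {s : Rook n} : Cell.input s ∉ workCells n k := by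
  simp [workCells]

theorem output_notMem_workCells {k : ℕ} {s : Rook n} : Cell.output s ∉ workCells n k := by
  simp [workCells]

theorem nodup_workCells (n k : ℕ) : (workCells n k).Nodup := by
  rw [workCells, List.nodup_flatMap]
  refine ⟨fun s _ => List.Nodup.map (fun m m' h => (Cell.work.inj h).2) List.nodup_range', ?_⟩
  refine (Finset.nodup_toList _).imp fun {s s'} hne => ?_
  simp only [Function.onFun, List.disjoint_left, List.mem_map]
  rintro c ⟨m, _, rfl⟩ ⟨m', _, h⟩
  exact hne (Cell.work.inj h).1.symm

theorem card_workCells_le (n k : ℕ) : (workCells n k).toFinset.card ≤ maxWork n := by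
  refine (List.toFinset_card_le _).trans (le_trans (le_of_eq ?_) (work_le_maxWork n k))
  rw [mul_assoc, ← card_rank_eq]
  simp [workCells, elemsOfRank, List.length_flatMap, mul_comm]

/-- The cells held at the end of step `n - k`. -/
noncomputable def stepCells (n k : ℕ) : Finset (Cell n) :=
  Finset.univ.image Cell.input ∪ Finset.univ.image Cell.output ∪ (workCells n k).toFinset
    ∪ (workCells n (k + 1)).toFinset ∪ (workCells n (k + 2)).toFinset

theorem input_mem_stepCells {k : ℕ} {s : Rook n} : Cell.input s ∈ stepCells n k := by
  simp [stepCells]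

theorem output_mem_stepCells {k : ℕ} {s : Rook n} : Cell.output s ∈ stepCells n k := by
  simp [stepCells]

theorem work_mem_stepCells {k m : ℕ} {s : Rook n} :
    Cell.work s m ∈ stepCells n k ↔ (k ≤ rk s ∧ rk s ≤ k + 2) ∧ 1 ≤ m ∧ m < n - rk s := by
  simp only [stepCells, Finset.mem_union, Finset.mem_image, List.mem_toFinset, work_mem_workCells]
  simp
  omega

theorem loc_mem_stepCells {k m : ℕ} {s : Rook n} (h1 : k ≤ rk s) (h2 : rk s ≤ k + 2)
    (hm : m ≤ n - rk s) : loc s m ∈ stepCells n k := by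
  unfold loc
  split_ifs
  · exact input_mem_stepCells
  · exact output_mem_stepCells
  · exact work_mem_stepCells.2 ⟨⟨h1, h2⟩, by omega, by omega⟩

theorem card_stepCells_le (n k : ℕ) :
    (stepCells n k).card ≤ 2 * Fintype.card (Rook n) + 3 * maxWork n := by
  have h1 : (Finset.univ.image (Cell.input (n := n))).card ≤ Fintype.card (Rook n) :=
    Finset.card_image_le
  have h2 : (Finset.univ.image (Cell.output (n := n))).card ≤ Fintype.card (Rook n) :=
    Finset.card_image_le
  have h3 := card_workCells_le n k
  have h4 := card_workCells_le n (k + 1)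
  have h5 := card_workCells_le n (k + 2)
  have h : (stepCells n k).card ≤ _ := (Finset.card_union_le _ _).trans (Nat.add_le_add_right
    ((Finset.card_union_le _ _).trans (Nat.add_le_add_right ((Finset.card_union_le _ _).trans
      (Nat.add_le_add_right (Finset.card_union_le _ _) _)) _)) _)
  omega

/-- The state of the memory at the end of step `n - k`. -/
def StepInvariant (f : Rook n → ℂ) (k : ℕ) (M : Memory n) : Prop :=
  M.cells = stepCells n k ∧ (∀ s, M.val (.input s) = f s) ∧ ∀ s, k ≤ rk s → Holds f M.val s

/-- `Holds` speaks of `val`, which freeing leaves intact, so it persists for all higher ranks;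
whether a cell may be read is decided by `stepCells` alone. Allocation resets only work cells of
rank k. -/
theorem exec_step {B k : ℕ} {f : Rook n → ℂ} {M : Memory n}
    (hB : 2 * Fintype.card (Rook n) + 3 * maxWork n ≤ B) (hM : StepInvariant f (k + 1) M) :
    ∃ M', Exec B (step n k) M M' ∧ StepInvariant f k M' := by
  obtain ⟨C, V⟩ := M
  obtain ⟨rfl, hin, hH⟩ := hM
  dsimp only at hin hH
  have hcells : (stepCells n (k + 1) \ (workCells n (k + 3)).toFinset) ∪
      (workCells n k).toFinset = stepCells n k := by
    ext c
    rw [Finset.mem_union, Finset.mem_sdiff, List.mem_toFinset, List.mem_toFinset]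
    rcases c with s | s | ⟨s, m⟩
    · simp [input_mem_stepCells, input_notMem_workCells]
    · simp [output_mem_stepCells, output_notMem_workCells]
    · rw [work_mem_stepCells, work_mem_stepCells, work_mem_workCells, work_mem_workCells]
      omega
  have hfree := exec_frees (B := B) (workCells n (k + 3)) (nodup_workCells n (k + 3))
    ⟨stepCells n (k + 1), V⟩ (fun c hc => by simp [stepCells, hc])
    ((card_stepCells_le n (k + 1)).trans hB)
  obtain ⟨V₁, halloc, hV₁⟩ := exec_allocs (B := B) (workCells n k) (nodup_workCells n k)
    ⟨stepCells n (k + 1) \ (workCells n (k + 3)).toFinset, V⟩ (fun c hc h => by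
      rcases c with s | s | ⟨s, m⟩
      · exact input_notMem_workCells hc
      · exact output_notMem_workCells hc
      · have h1 := work_mem_workCells.1 hc
        have h2 := work_mem_stepCells.1 (Finset.mem_sdiff.1 h).1
        omega)
    (by rw [hcells]; exact (card_stepCells_le n k).trans hB)
  dsimp only at halloc hV₁
  rw [hcells] at halloc
  obtain ⟨V₂, hE, hin₂, hl₂, hH₂⟩ := exec_computeAll_flatMap (f := f) (V := V₁)
    (elemsOfRank n k) (fun s hs => mem_elemsOfRank.1 hs) ((card_stepCells_le n k).trans hB)
    (fun s h1 h2 i hi => loc_mem_stepCells h1 h2 hi) (fun s => output_mem_stepCells)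
    (fun s => (hV₁ _ input_notMem_workCells).trans (hin s)) (fun s hs => by
      refine ⟨fun m hm => ?_, ?_⟩
      · rw [hV₁, (hH s hs).1 m hm]
        unfold loc
        split_ifs
        · exact input_notMem_workCells
        · exact output_notMem_workCells
        · rw [work_mem_workCells]
          omega
      · rw [hV₁ _ output_notMem_workCells, (hH s hs).2])
  refine ⟨_, (hfree.append halloc).append hE, rfl, hin₂, fun s hs => ?_⟩
  rcases hs.eq_or_lt with h | h
  · exact hl₂ s (mem_elemsOfRank.2 h.symm)
  · refine hH₂ s ⟨fun m hm => ?_, ?_⟩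
    · rw [hV₁, (hH s h).1 m hm]
      unfold loc
      split_ifs
      · exact input_notMem_workCells
      · exact output_notMem_workCells
      · rw [work_mem_workCells]
        omega
    · rw [hV₁ _ output_notMem_workCells, (hH s h).2]

/-- The induction starts at the empty rank n + 1, where all three layers of work cells are empty. -/
theorem stepInvariant_initialMemory (f : Rook n → ℂ) :
    StepInvariant f (n + 1) (initialMemory f) := by
  refine ⟨?_, fun s => rfl, fun s hs => absurd (rk_le s) (by omega)⟩
  ext c
  rcases c with s | s | ⟨s, m⟩
  · simp [initialMemory, input_mem_stepCells]
  · simp [initialMemory, output_mem_stepCells]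
  · rw [work_mem_stepCells]
    simp [initialMemory]
    omega

theorem exec_steps {B : ℕ} (f : Rook n → ℂ)
    (hB : 2 * Fintype.card (Rook n) + 3 * maxWork n ≤ B) {j : ℕ} (hj : j ≤ n + 1) :
    ∃ M, Exec B (steps n j) (initialMemory f) M ∧ StepInvariant f (n + 1 - j) M := by
  induction j with
  | zero =>
    have h := stepInvariant_initialMemory f
    exact ⟨_, .nil (h.1 ▸ (card_stepCells_le n (n + 1)).trans hB), h⟩
  | succ j ih =>
    obtain ⟨M, hE, hM⟩ := ih (by omega)
    rw [show n + 1 - j = n - j + 1 by omega] at hM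
    obtain ⟨M', hE', hM'⟩ := exec_step hB hM
    refine ⟨M', ?_, by rwa [show n + 1 - (j + 1) = n - j by omega]⟩
    rw [steps, List.range_succ, List.flatMap_append, List.flatMap_singleton]
    exact hE.append hE'

end RookZeta

/-! ### The main theorem -/

theorem mainTheorem7 :
    (∃ C : ℝ, ∀ n : ℕ, 1 ≤ n → ∀ f : RookZeta.Rook n → ℂ,
      -- at every point of the execution, which never fails, few numbers are stored
      (∀ p : List (RookZeta.Instr n), p <+: RookZeta.fastZeta n →
        ∃ M : RookZeta.Memory n, RookZeta.run p (RookZeta.initialMemory f) = some M ∧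
          (M.cells.card : ℝ) ≤
            C * ((n : ℝ) ^ (1 / 4 : ℝ) * (Fintype.card (RookZeta.Rook n) : ℝ))) ∧
      -- after step `n - k` all partial zeta transforms at the elements of rank `k` are in memory
      (∀ k : ℕ, k ≤ n → ∃ M : RookZeta.Memory n,
        RookZeta.run (RookZeta.steps n (n - k + 1)) (RookZeta.initialMemory f) = some M ∧
          ∀ s : RookZeta.Rook n, RookZeta.rk s = k → ∀ m : ℕ, m ≤ n - k →
            RookZeta.loc s m ∈ M.cells ∧
              M.val (RookZeta.loc s m) = RookZeta.partialZeta f s m) ∧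
      -- at the end the zeta transform is in memory
      (∃ M : RookZeta.Memory n,
        RookZeta.run (RookZeta.fastZeta n) (RookZeta.initialMemory f) = some M ∧
          ∀ s : RookZeta.Rook n, RookZeta.Cell.output s ∈ M.cells ∧
            M.val (RookZeta.Cell.output s) = RookZeta.zeta f s)) ∧
    -- the underlying estimate for the numbers of work cells allocated in the single steps
    (∃ C : ℝ, ∀ n : ℕ, 1 ≤ n →
      (((Finset.range n).sup fun k => (n - k - 1) * n.choose k ^ 2 * k ! : ℕ) : ℝ) ≤
        C * ((n : ℝ) ^ (1 / 4 : ℝ) * (Fintype.card (RookZeta.Rook n) : ℝ))) := by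
  -- The 2 pays for inputs and outputs, since n^{1/4} ≥ 1; each of the three work layers costs e⁴.
  refine ⟨⟨2 + 3 * Real.exp 4, fun n hn f => ?_⟩, Real.exp 4, fun n _ => RookZeta.maxWork_le n⟩
  have hexec := fun j => RookZeta.exec_steps (j := j) f le_rfl
  refine ⟨fun p hp => ?_, fun k hk => ?_, ?_⟩
  · obtain ⟨M, hE, -⟩ := hexec (n + 1) le_rfl
    obtain ⟨N, hN, hB⟩ := hE.exists_of_prefix hp
    refine ⟨N, hN, ?_⟩
    have h1 : (N.cells.card : ℝ) ≤
        2 * Fintype.card (RookZeta.Rook n) + 3 * RookZeta.maxWork n := by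
      exact_mod_cast hB
    have h2 := RookZeta.maxWork_le n
    have h3 : (1 : ℝ) ≤ (n : ℝ) ^ (1 / 4 : ℝ) :=
      Real.one_le_rpow (by exact_mod_cast hn) (by norm_num)
    have h4 : (Fintype.card (RookZeta.Rook n) : ℝ) ≤
        (n : ℝ) ^ (1 / 4 : ℝ) * Fintype.card (RookZeta.Rook n) :=
      le_mul_of_one_le_left (by positivity) h3
    linarith
  · obtain ⟨M, hE, hM⟩ := hexec (n - k + 1) (by omega)
    rw [show n + 1 - (n - k + 1) = k by omega] at hM
    obtain ⟨hcells, -, hH⟩ := hM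
    refine ⟨M, hE.run_eq, fun s hs m hm => ⟨?_, (hH s hs.ge).1 m (hs ▸ hm)⟩⟩
    rw [hcells]
    exact RookZeta.loc_mem_stepCells hs.ge (by omega) (hs ▸ hm)
  · obtain ⟨M, hE, hcells, -, hH⟩ := hexec (n + 1) le_rfl
    refine ⟨M, hE.run_eq, fun s => ⟨?_, (hH s (by omega)).2⟩⟩
    rw [hcells]
    exact RookZeta.output_mem_stepCells
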